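/- Let $\mathbb F$ be a finite field with $q$ elements and let $b\ge 0$. A *flag juggling state* is a word in the letters $-,1,\dots,b$, indexed by the positions $0,1,2,\dots$, in which each of the numbers $1,\dots,b$ occurs exactly once and all other letters are $-$; letters are compared with $-$ regarded as $+\infty$. Let $U_b$ be the set of $b\times\mathbb N$ matrices over $\mathbb F$ of rank $b$. For $M\in U_b$ the *flag invariant* $\tilde\sigma(M)$ is the unique state $\tilde\tau$ such that $M$ is obtained, by downward row operations (left multiplication by an invertible lower triangular matrix) and rightward column operations (right multiplication by an upper triangular $\mathbb N\times\mathbb N$ matrix with ones on the diagonal), from the partial permutation matrix whose entry $(i,j)$ is $1$ exactly when $\tilde\tau$ has the number $i$ in position $j$. *Digraph.* If $\tilde\tau$ begins with $-$, its only outgoing edge goes to $\tilde\tau$ with that $-$ removed. Otherwise remove the first letter of $\tilde\tau$, carry it, and walk right through the remaining word: at any $-$ one may replace the $-$ by the carried number and be done; at any number strictly larger than the carried one, one may pick up that number, drop the carried one in its place, and keep walking. There is an edge $\tilde\tau\to\tilde\tau''$ for each word $\tilde\tau''$ that can result after finitely many steps. *Backward bumping process from $\tilde\tau$.* Take a coin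 with probability $1/q$ of heads. (1) Hold a $-$ and point at the rightmost number of $\tilde\tau$. (2) Flip the coin; on tails put down what is held and pick up the number pointed at; on heads do nothing. (3) Move left, stopping at the first number smaller than what is held. (4) If there is such a number, go back to (2); otherwise attach what is held at the left end of the (modified) word and stop. (If there are no numbers, i.e. $b=0$, a $-$ is attached at the left end.) **Proposition.** Let $\tilde\tau$ be a flag juggling state, let $M\in U_b$ be the partial permutation matrix with $\tilde\sigma(M)=\tilde\tau$, and let $\vec c$ be uniformly distributed on $\mathbb F^b$. Then for every flag juggling state $\tau'$, the probability that $\tilde\sigma([\vec c\ M])=\tau'$ equals the probability that the backward bumping process started at $\tilde\tau$ ends at $\tau'$. In particular, the states $\tau'$ for which this probability is positive are exactly those with an edge $\tau'\to\tilde\tau$ in the digraph. -/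

import Mathlib

open scoped NNReal ENNReal

namespace FlagJuggling

/-- A flag juggling state with labels `1, …, b`: a word indexed by the positions `0, 1, 2, …`
in which every label is used exactly once, all other letters being a dash.  It is recorded by the
injective map sending a label to its position; the element `i : Fin b` is the label `i + 1`. -/
abbrev FlagState (b : ℕ) := Fin b ↪ ℕ

/-- The letter at position `j` of the word: a label, or `⊤` for a dash (so that a dash counts
as `+∞` when letters are compared). -/
def letter {b : ℕ} (s : FlagState b) (j : ℕ) : WithTop (Fin b) :=
  (Finset.univ.filter fun i => s i = j).min

theorem letter_eq_coe_iff {b : ℕ} (s : FlagState b) (j : ℕ) (i : Fin b) :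
    letter s j = i ↔ s i = j := by
  constructor
  · intro h
    simpa using Finset.mem_of_min h
  · intro h
    have : (Finset.univ.filter fun k => s k = j) = {i} := by
      ext k
      simp only [Finset.mem_filter, Finset.mem_univ, true_and, Finset.mem_singleton]
      rw [← h]
      exact s.injective.eq_iff
    rw [letter, this, Finset.min_singleton]

theorem letter_eq_top_iff {b : ℕ} (s : FlagState b) (j : ℕ) :
    letter s j = ⊤ ↔ ∀ i, s i ≠ j := by
  simp [letter, Finset.min_eq_top, Finset.filter_eq_empty_iff]

/-- The word obtained by exchanging the letters at positions `m` and `n`. -/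
def swapLetters {b : ℕ} (s : FlagState b) (m n : ℕ) : FlagState b :=
  s.trans (Equiv.swap m n).toEmbedding

/-- The word obtained by attaching a dash on the left. -/
def attachDash {b : ℕ} (s : FlagState b) : FlagState b :=
  s.trans ⟨Nat.succ, Nat.succ_injective⟩

/-! ### Matrices -/

/-- The `b × ℕ` matrices of full rank. -/
abbrev FullRankMatrix (F : Type*) [Field F] (b : ℕ) :=
  {M : Matrix (Fin b) ℕ F // LinearIndependent F M.row}

/-- The partial permutation matrix of a state: entry `(i, j)` is `1` if the label `i` is at
position `j`, and `0` otherwise. -/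
def permMatrix (F : Type*) [Field F] {b : ℕ} (s : FlagState b) : Matrix (Fin b) ℕ F :=
  Matrix.of fun i j => if s i = j then 1 else 0

/-- A partial permutation matrix: entries `0` and `1`, at most one `1` in each row and column. -/
def IsPartialPermutation {F : Type*} [Field F] {b : ℕ} (M : Matrix (Fin b) ℕ F) : Prop :=
  (∀ i j, M i j = 0 ∨ M i j = 1) ∧
    (∀ i j j', M i j = 1 → M i j' = 1 → j = j') ∧
    (∀ i i' j, M i j = 1 → M i' j = 1 → i = i')

/-- Rightward column operations: to each column `j` is added the linear combination
with coefficients `a k j` of the columns `k` to the left of it (this is right multiplication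
by an arbitrary upper triangular `ℕ × ℕ` matrix with ones on the diagonal). -/
def rightwardColumnOp {F : Type*} [Field F] {b : ℕ} (M : Matrix (Fin b) ℕ F) (a : ℕ → ℕ → F) :
    Matrix (Fin b) ℕ F :=
  Matrix.of fun i j => M i j + ∑ k ∈ Finset.range j, M i k * a k j

/-- An invertible lower triangular matrix; multiplying by it on the left performs downward row
operations (and rescalings of rows). -/
def IsDownwardRowOp {F : Type*} [Field F] {b : ℕ} (L : Matrix (Fin b) (Fin b) F) : Prop :=
  (∀ i k, i < k → L i k = 0) ∧ ∀ i, L i i ≠ 0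

/-- `M` is obtained from the partial permutation matrix of `s` by downward row operations and
rightward column operations. -/
def InOrbit {F : Type*} [Field F] {b : ℕ} (M : Matrix (Fin b) ℕ F) (s : FlagState b) : Prop :=
  ∃ (L : Matrix (Fin b) (Fin b) F) (a : ℕ → ℕ → F),
    IsDownwardRowOp L ∧ M = L * rightwardColumnOp (permMatrix F s) a

theorem colOp_permMatrix {F : Type*} [Field F] {b : ℕ} (s : FlagState b) (a : ℕ → ℕ → F)
    (i : Fin b) (j : ℕ) :
    rightwardColumnOp (permMatrix F s) a i j =
      if s i = j then 1 else if s i < j then a (s i) j else 0 := by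
  simp only [rightwardColumnOp, permMatrix, Matrix.of_apply, ite_mul, one_mul, zero_mul,
    Finset.sum_ite_eq, Finset.mem_range]
  split_ifs <;> first | omega | simp

theorem lower_zero {F : Type*} [Field F] {b : ℕ} {L : Matrix (Fin b) (Fin b) F}
    (hL : IsDownwardRowOp L) (v : Fin b → F) (h : ∀ i, ∑ k, L i k * v k = 0) (i : Fin b) :
    v i = 0 := by
  induction i using WellFoundedLT.induction with
  | ind i ih =>
    have h1 := h i
    rw [Finset.sum_eq_single i] at h1
    · exact (mul_eq_zero.mp h1).resolve_left (hL.2 i)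
    · intro k _ hk
      rcases lt_or_gt_of_ne hk with h2 | h2
      · rw [ih k h2, mul_zero]
      · rw [hL.1 i k h2, zero_mul]
    · simp

/-- Every matrix of full rank is in the orbit of some partial permutation matrix of rank `b`. -/
theorem exists_inOrbit {F : Type*} [Field F] : ∀ {b : ℕ} (M : Matrix (Fin b) ℕ F),
    LinearIndependent F M.row → ∃ s, InOrbit M s := by
  intro b
  induction b with
  | zero =>
    intro M _
    exact ⟨⟨fun i => i.elim0, fun i => i.elim0⟩, 1, 0, ⟨fun i => i.elim0, fun i => i.elim0⟩,
      by ext i; exact i.elim0⟩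
  | succ b ih =>
    classical
    intro M hM
    have h0 : ∃ p, M 0 p ≠ 0 := by
      by_contra! h
      exact hM.ne_zero 0 (funext h)
    let p := Nat.find h0
    have hp : M 0 p ≠ 0 := Nat.find_spec h0
    have hlt : ∀ j, j < p → M 0 j = 0 := fun j hj => by simpa using Nat.find_min h0 hj
    let M' : Matrix (Fin b) ℕ F := Matrix.of fun i j => M i.succ j - M i.succ p / M 0 p * M 0 j
    have hM' : LinearIndependent F M'.row := by
      rw [Fintype.linearIndependent_iff] at hM ⊢
      intro g hg i
      have := hM (Fin.cons (-∑ i, g i * (M i.succ p / M 0 p)) g) (by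
        ext j
        have := congrFun hg j
        simp only [Matrix.row, M', Finset.sum_apply, Pi.smul_apply, Matrix.of_apply, smul_eq_mul,
          Pi.zero_apply, mul_sub, Finset.sum_sub_distrib] at this
        simp only [Fin.sum_univ_succ, Fin.cons_zero, Fin.cons_succ, Matrix.row,
          Finset.sum_apply, Pi.smul_apply, smul_eq_mul, Pi.zero_apply, neg_mul, Finset.sum_mul]
        rw [← this]
        simp only [mul_assoc]
        ring) i.succ
      simpa using this
    obtain ⟨s, L, a, hL, hE⟩ := ih M' hM'
    have hE' : ∀ i j, M' i j = ∑ k, L i k *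
        (if s k = j then 1 else if s k < j then a (s k) j else 0) := by
      intro i j
      rw [hE, Matrix.mul_apply]
      simp only [colOp_permMatrix]
    have hsp : ∀ k, s k ≠ p := by
      intro k hk
      have := lower_zero hL
        (fun k => if s k = p then 1 else if s k < p then a (s k) p else 0)
        (fun i => by
          rw [← hE']
          simp [M', hp]) k
      simp [hk] at this
    refine ⟨⟨Fin.cons p s, ?_⟩, Matrix.of (Fin.cons (Fin.cons (M 0 p) 0)
      fun i => Fin.cons (M i.succ p) (L i)), Function.update a p fun j => M 0 j / M 0 p, ⟨?_, ?_⟩, ?_⟩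
    · rw [Fin.cons_injective_iff]
      exact ⟨by rintro ⟨k, hk⟩; exact hsp k hk, s.injective⟩
    · intro i k hik
      induction i using Fin.cases with
      | zero =>
        induction k using Fin.cases with
        | zero => simp at hik
        | succ k => simp
      | succ i =>
        induction k using Fin.cases with
        | zero => simp at hik
        | succ k => simpa using hL.1 i k (by simpa using hik)
    · intro i
      induction i using Fin.cases with
      | zero => simpa using hp
      | succ i => simpa using hL.2 i
    · have key : ∀ j, (if p = j then (1 : F) else if p < j then M 0 j / M 0 p else 0)
          = M 0 j / M 0 p := by
        intro j
        split_ifs with h1 h2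
        · rw [← h1, div_self hp]
        · rfl
        · rw [hlt j (by omega), zero_div]
      ext i j
      rw [Matrix.mul_apply]
      simp only [colOp_permMatrix, Fin.sum_univ_succ, Function.Embedding.coeFn_mk, Fin.cons_zero,
        Fin.cons_succ, Function.update_self, Function.update_of_ne (hsp _), key]
      induction i using Fin.cases with
      | zero => simp [mul_div_cancel₀ _ hp]
      | succ i =>
        simp only [Matrix.of_apply, Fin.cons_succ, Fin.cons_zero]
        rw [← hE']
        simp only [M', Matrix.of_apply]
        ring

/-- A matrix lies in the orbit of at most one partial permutation matrix of rank `b`. -/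
theorem inOrbit_unique {F : Type*} [Field F] {b : ℕ} {M : Matrix (Fin b) ℕ F}
    {s t : FlagState b} (hs : InOrbit M s) (ht : InOrbit M t) : s = t := by
  classical
  obtain ⟨L, a, hL, rfl⟩ := hs
  obtain ⟨K, c, hK, h⟩ := ht
  have bt : ∀ {L : Matrix (Fin b) (Fin b) F}, IsDownwardRowOp L →
      L.BlockTriangular OrderDual.toDual := fun hL i j hij => hL.1 i j (by simpa using hij)
  have hdet : IsUnit K.det := by
    rw [Matrix.det_of_isLowerTriangular K (bt hK)]
    exact (Finset.prod_ne_zero_iff.mpr fun i _ => hK.2 i).isUnit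
  let _ := K.invertibleOfIsUnitDet hdet
  have hN : (K⁻¹ * L).BlockTriangular OrderDual.toDual :=
    (Matrix.blockTriangular_inv_of_blockTriangular (bt hK)).mul (bt hL)
  have h' : rightwardColumnOp (permMatrix F t) c =
      K⁻¹ * L * rightwardColumnOp (permMatrix F s) a := by
    rw [Matrix.mul_assoc, h, Matrix.nonsing_inv_mul_cancel_left _ _ hdet]
  generalize K⁻¹ * L = N at hN h'
  have hE : ∀ i j, (if t i = j then (1 : F) else if t i < j then c (t i) j else 0) =
      ∑ k, N i k * (if s k = j then 1 else if s k < j then a (s k) j else 0) := by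
    intro i j
    rw [← colOp_permMatrix, h', Matrix.mul_apply]
    simp only [colOp_permMatrix]
  have main : ∀ i, ∃ k, k ≤ i ∧ s k = t i := by
    intro i
    have hne : (Finset.univ.filter fun k => N i k ≠ 0).Nonempty := by
      by_contra hcon
      rw [Finset.not_nonempty_iff_eq_empty, Finset.filter_eq_empty_iff] at hcon
      have := hE i (t i)
      rw [Finset.sum_eq_zero fun k _ => by rw [not_not.mp (hcon (Finset.mem_univ k)), zero_mul]]
        at this
      simp at this
    obtain ⟨k, hk, hmin⟩ := Finset.exists_min_image _ s hne
    simp only [Finset.mem_filter, Finset.mem_univ, true_and] at hk hmin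
    have hval : ∀ j, j ≤ s k →
        ∑ m, N i m * (if s m = j then 1 else if s m < j then a (s m) j else 0) =
          if j = s k then N i k else 0 := by
      intro j hj
      have hz : ∀ m, m ≠ k → N i m * (if s m = j then 1 else if s m < j then a (s m) j else 0) = 0 := by
        intro m hm
        by_cases h0 : N i m = 0
        · rw [h0, zero_mul]
        · have h1 := hmin m h0
          have h2 : s m ≠ s k := fun h => hm (s.injective h)
          rw [if_neg (by omega), if_neg (by omega), mul_zero]
      rw [Finset.sum_eq_single k (fun m _ hm => hz m hm) (by simp)]
      by_cases h3 : j = s k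
      · simp [h3]
      · rw [if_neg (by omega), if_neg (by omega), if_neg h3, mul_zero]
    refine ⟨k, ?_, ?_⟩
    · by_contra hlt
      exact hk (hN (by simpa using hlt))
    · rcases lt_trichotomy (s k) (t i) with h1 | h1 | h1
      · have := hE i (s k)
        rw [hval _ le_rfl, if_pos rfl, if_neg (by omega), if_neg (by omega)] at this
        exact absurd this.symm hk
      · exact h1
      · have := hE i (t i)
        rw [hval _ h1.le, if_neg h1.ne] at this
        simp at this
  ext i
  induction i using WellFoundedLT.induction with
  | ind i ih =>
    obtain ⟨k, hk, hkt⟩ := main i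
    rcases hk.lt_or_eq with h1 | h1
    · exact absurd (t.injective ((ih k h1).symm.trans hkt)) h1.ne
    · rw [← hkt, h1]

/-- The flag invariant of a matrix of full rank: the unique state whose partial permutation matrix
can be turned into `M` by downward row operations and rightward column operations. -/
noncomputable def flagInvariant {F : Type*} [Field F] {b : ℕ} (M : FullRankMatrix F b) :
    FlagState b :=
  (exists_inOrbit M.1 M.2).choose

theorem flagInvariant_eq_iff {F : Type*} [Field F] {b : ℕ} (M : FullRankMatrix F b)
    (s : FlagState b) : flagInvariant M = s ↔ InOrbit M.1 s :=
  ⟨fun h => h ▸ (exists_inOrbit M.1 M.2).choose_spec,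
    fun h => inOrbit_unique (exists_inOrbit M.1 M.2).choose_spec h⟩

/-- Each state is the flag invariant of exactly one partial permutation matrix of full rank. -/
theorem existsUnique_partialPermutation (F : Type*) [Field F] {b : ℕ} (s : FlagState b) :
    ∃! M : FullRankMatrix F b, IsPartialPermutation M.1 ∧ flagInvariant M = s := by
  have orb : ∀ t : FlagState b, InOrbit (permMatrix F t) t := fun t =>
    ⟨1, 0, ⟨fun i k h => Matrix.one_apply_ne h.ne, fun i => by simp⟩, by
      rw [Matrix.one_mul]
      ext i j
      simp [rightwardColumnOp]⟩
  refine ⟨⟨permMatrix F s, ?_⟩, ⟨⟨?_, ?_, ?_⟩, (flagInvariant_eq_iff _ _).2 (orb s)⟩, ?_⟩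
  · rw [Fintype.linearIndependent_iff]
    intro g hg i
    simpa [Matrix.row, permMatrix] using congrFun hg (s i)
  · intro i j
    by_cases h : s i = j <;> simp [permMatrix, h]
  · intro i j j' h h'
    simp only [permMatrix, Matrix.of_apply, ite_eq_left_iff, zero_ne_one, imp_false, not_not]
      at h h'
    exact h.symm.trans h'
  · intro i i' j h h'
    simp only [permMatrix, Matrix.of_apply, ite_eq_left_iff, zero_ne_one, imp_false, not_not]
      at h h'
    exact s.injective (h.trans h'.symm)
  · rintro ⟨M, hM⟩ ⟨⟨h01, hr, hc⟩, hs⟩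
    have h1 : ∀ i, ∃ j, M i j = 1 := by
      intro i
      by_contra! h
      exact hM.ne_zero i (funext fun j => (h01 i j).resolve_right (h j))
    choose t ht using h1
    let r : FlagState b := ⟨t, fun i i' h => hc i i' (t i) (ht i) (h ▸ ht i')⟩
    have hMt : M = permMatrix F r := by
      ext i j
      change M i j = if t i = j then 1 else 0
      split_ifs with h
      · rw [← h, ht i]
      · exact (h01 i j).resolve_right fun h' => h (hr i _ _ (ht i) h')
    rw [flagInvariant_eq_iff] at hs
    have hsr : s = r := inOrbit_unique hs (by change InOrbit M r; rw [hMt]; exact orb r)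
    exact Subtype.ext (hMt.trans (congrArg (permMatrix F) hsr.symm))

/-- The matrix `[c M]`. -/
def prependColumn {F : Type*} [Field F] {b : ℕ} (c : Fin b → F) (M : FullRankMatrix F b) :
    FullRankMatrix F b :=
  ⟨Matrix.of fun i j =>
      match j with
      | 0 => c i
      | k + 1 => M.1 i k,
    LinearIndependent.of_comp (LinearMap.funLeft F F Nat.succ) M.2⟩

/-- The distribution of the flag invariant of `[c M]`, for `c` uniformly distributed on `F ^ b`. -/
noncomputable def randomColumnLaw {F : Type*} [Field F] [Fintype F] {b : ℕ}
    (M : FullRankMatrix F b) : PMF (FlagState b) :=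
  (PMF.uniformOfFintype (Fin b → F)).map fun c => flagInvariant (prependColumn c M)

/-! ### The backward process -/

/-- A coin with probability `1 / q` of heads (`true` is heads). -/
noncomputable def coin (q : ℝ≥0) (hq : 1 ≤ q) : PMF Bool :=
  PMF.ofFintype (fun heads => cond heads ((q⁻¹ : ℝ≥0) : ℝ≥0∞) (1 - ((q⁻¹ : ℝ≥0) : ℝ≥0∞))) (by
    have h : ((q⁻¹ : ℝ≥0) : ℝ≥0∞) ≤ 1 := by
      exact_mod_cast inv_le_one_of_one_le₀ hq
    simp [add_tsub_cancel_of_le h])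

/-- The leftward walk of the backward process.  The word `s` consists of what is currently held
(the letter at position `0`) followed by the current word (its position `j` is the position
`j + 1` of `s`).  The positions `n, n - 1, …, 1` of `s` are still to be visited, in this order.
At a letter smaller than the held one a coin is flipped; on tails the two are exchanged.  When
all positions have been visited, the held letter is dropped at the left end, which gives `s`. -/
noncomputable def backwardWalk (q : ℝ≥0) (hq : 1 ≤ q) {b : ℕ} :
    ℕ → FlagState b → PMF (FlagState b)
  | 0, s => PMF.pure s
  | n + 1, s =>
    if letter s (n + 1) < letter s 0 then
      (coin q hq).bind fun heads =>
        if heads then backwardWalk q hq n s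
        else backwardWalk q hq n (swapLetters s 0 (n + 1))
    else backwardWalk q hq n s

/-- The number of positions of the word up to and including its rightmost label. -/
def width {b : ℕ} (s : FlagState b) : ℕ := Finset.univ.sup fun i => s i + 1

/-- The backward bumping process started at `s`: hold a dash, point at the rightmost number of `s`,
and walk leftwards. -/
noncomputable def backwardBumping (q : ℝ≥0) (hq : 1 ≤ q) {b : ℕ} (s : FlagState b) :
    PMF (FlagState b) :=
  backwardWalk q hq (width s) (attachDash s)

theorem one_le_card (F : Type*) [Field F] [Fintype F] : (1 : ℝ≥0) ≤ (Fintype.card F : ℝ≥0) := by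
  exact_mod_cast Fintype.card_pos

/-! ### The digraph -/

/-- The eastward walk.  In the word `s` the letter at position `0` is the number being carried, and
the positions `n, n + 1, …` are still to be visited; `ThrowWalk t n s` says that the walk can end
with the word `t`, where position `0` (the hand) then holds the dash that was replaced. -/
inductive ThrowWalk {b : ℕ} (t : FlagState b) : ℕ → FlagState b → Prop
  /-- Continue walking without doing anything at position `n`. -/
  | skip (n : ℕ) (s : FlagState b) : ThrowWalk t (n + 1) s → ThrowWalk t n s
  /-- Pick up a strictly larger number, dropping the carried number in its place. -/
  | bump (n : ℕ) (s : FlagState b) : letter s n ≠ ⊤ → letter s 0 < letter s n →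
      ThrowWalk t (n + 1) (swapLetters s 0 n) → ThrowWalk t n s
  /-- Replace a dash with the carried number and be done. -/
  | place (n : ℕ) (s : FlagState b) : letter s n = ⊤ → swapLetters s 0 n = t → ThrowWalk t n s

/-- The edges `s ⟶ t` of the flag juggling digraph.  If `s` begins with a dash, then `t` is `s`
with that dash removed; otherwise the first letter of `s` is picked up and carried eastwards,
and `t` is the resulting word, with position `0` removed. -/
def FlagEdge {b : ℕ} (s t : FlagState b) : Prop :=
  (letter s 0 = ⊤ ∧ s = attachDash t) ∨ (letter s 0 ≠ ⊤ ∧ ThrowWalk (attachDash t) 1 s)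

end FlagJuggling

/-!
If `M` is `L` times a column-operated partial permutation matrix, then replacing the uniform vector
`c` by `L c` allows one to assume that `M` is this partial permutation matrix.

Column `0` of `[c M]` plays the part of the hand, and the labels are visited from right to left.
Let `k` be the label at the position visited.  If `c k = 0`, nothing has to be done.  If the hand
holds a label smaller than `k`, a downward row operation with the `1` of the held label in
column `0` clears `c k`.  Otherwise a nonzero `c k` becomes the pivot of column `0`: it clears the
old pivot of row `k` by a column operation and the `1` of the held label, if there is one, by a row
operation, which recreates the latter in the old column of `k`; so `k` and the held letter are
exchanged.  The coin of label `k` thus shows heads exactly when `c k = 0`, and these coins are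
independent because `c` is uniformly distributed.

For the support, every exchange in the leftward walk undoes one step of a throw.
-/

namespace FlagJuggling

section Orbits

variable {F : Type*} [Field F] {b : ℕ}

theorem IsDownwardRowOp.mul {K L : Matrix (Fin b) (Fin b) F} (hK : IsDownwardRowOp K)
    (hL : IsDownwardRowOp L) : IsDownwardRowOp (K * L) := by
  refine ⟨fun i k hik => ?_, fun i => ?_⟩
  · rw [Matrix.mul_apply]
    refine Finset.sum_eq_zero fun j _ => ?_
    rcases lt_or_ge i j with hij | hji
    · rw [hK.1 i j hij, zero_mul]
    · rw [hL.1 j k (hji.trans_lt hik), mul_zero]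
  · rw [Matrix.mul_apply, Finset.sum_eq_single i]
    · exact mul_ne_zero (hK.2 i) (hL.2 i)
    · intro j _ hj
      rcases hj.lt_or_gt with hji | hij
      · rw [hL.1 j i hji, mul_zero]
      · rw [hK.1 i j hij, zero_mul]
    · simp

theorem rightwardColumnOp_mul (L : Matrix (Fin b) (Fin b) F) (N : Matrix (Fin b) ℕ F)
    (a : ℕ → ℕ → F) : rightwardColumnOp (L * N) a = L * rightwardColumnOp N a := by
  ext i j
  simp only [rightwardColumnOp, Matrix.of_apply, Matrix.mul_apply, Finset.sum_mul, mul_add,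
    Finset.sum_add_distrib, Finset.mul_sum, mul_assoc]
  rw [Finset.sum_comm]

/-- Row `i` of `N` has its first nonzero entry at position `s i`.  Rightward column operations
preserve this, so they need never be composed in order to compare orbits. -/
def HasPivots (N : Matrix (Fin b) ℕ F) (s : FlagState b) : Prop :=
  ∀ i, (∀ j < s i, N i j = 0) ∧ N i (s i) ≠ 0

theorem HasPivots.rightwardColumnOp {N : Matrix (Fin b) ℕ F} {s : FlagState b}
    (hN : HasPivots N s) (a : ℕ → ℕ → F) : HasPivots (rightwardColumnOp N a) s := by
  have entry_eq : ∀ i j, j ≤ s i → FlagJuggling.rightwardColumnOp N a i j = N i j := by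
    intro i j hj
    rw [FlagJuggling.rightwardColumnOp, Matrix.of_apply, Finset.sum_eq_zero, add_zero]
    intro k hk
    rw [(hN i).1 k ((Finset.mem_range.1 hk).trans_le hj), zero_mul]
  refine fun i => ⟨fun j hj => ?_, ?_⟩
  · rw [entry_eq i j hj.le, (hN i).1 j hj]
  · rw [entry_eq i _ le_rfl]
    exact (hN i).2

theorem hasPivots_permMatrix (s : FlagState b) : HasPivots (permMatrix F s) s := fun i =>
  ⟨fun j hj => by simp [permMatrix, hj.ne'], by simp [permMatrix]⟩

theorem HasPivots.inOrbit {N : Matrix (Fin b) ℕ F} {s : FlagState b} (hN : HasPivots N s) :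
    InOrbit N s := by
  classical
  refine ⟨Matrix.diagonal fun i => N i (s i), Function.extend s (fun i j => N i j / N i (s i)) 0,
    ⟨fun i k hik => Matrix.diagonal_apply_ne _ hik.ne, fun i => ?_⟩, ?_⟩
  · rw [Matrix.diagonal_apply_eq]
    exact (hN i).2
  · ext i j
    rw [Matrix.diagonal_mul, colOp_permMatrix, s.injective.extend_apply]
    split_ifs with heq hlt
    · rw [← heq, mul_one]
    · rw [mul_div_cancel₀ _ (hN i).2]
    · rw [(hN i).1 j (by omega), mul_zero]

theorem inOrbit_iff_exists_hasPivots {M : Matrix (Fin b) ℕ F} {s : FlagState b} :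
    InOrbit M s ↔ ∃ (L : Matrix (Fin b) (Fin b) F) (N : Matrix (Fin b) ℕ F),
      IsDownwardRowOp L ∧ HasPivots N s ∧ M = L * N := by
  constructor
  · rintro ⟨L, a, hL, rfl⟩
    exact ⟨L, _, hL, (hasPivots_permMatrix s).rightwardColumnOp a, rfl⟩
  · rintro ⟨L, N, hL, hN, rfl⟩
    obtain ⟨D, a, hD, rfl⟩ := hN.inOrbit
    exact ⟨L * D, a, hL.mul hD, (Matrix.mul_assoc _ _ _).symm⟩

theorem InOrbit.mul_rightwardColumnOp {M : Matrix (Fin b) ℕ F} {s : FlagState b}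
    (hM : InOrbit M s) {L : Matrix (Fin b) (Fin b) F} (hL : IsDownwardRowOp L) (a : ℕ → ℕ → F) :
    InOrbit (L * rightwardColumnOp M a) s := by
  rw [inOrbit_iff_exists_hasPivots] at hM ⊢
  obtain ⟨K, N, hK, hN, rfl⟩ := hM
  exact ⟨L * K, _, hL.mul hK, hN.rightwardColumnOp a, by
    rw [rightwardColumnOp_mul, Matrix.mul_assoc]⟩

theorem flagInvariant_eq_of_eq_mul_rightwardColumnOp {M N : FullRankMatrix F b}
    {L : Matrix (Fin b) (Fin b) F} (hL : IsDownwardRowOp L) (a : ℕ → ℕ → F)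
    (h : M.1 = L * rightwardColumnOp N.1 a) : flagInvariant M = flagInvariant N := by
  rw [flagInvariant_eq_iff, h]
  exact ((flagInvariant_eq_iff N _).1 rfl).mul_rightwardColumnOp hL a

theorem flagInvariant_eq_of_scale_add_row {M N : FullRankMatrix F b} (a : ℕ → ℕ → F) (k : Fin b)
    (d u : Fin b → F) (hd : ∀ i, d i ≠ 0) (hu : ∀ i ≤ k, u i = 0)
    (h : ∀ i j, M.1 i j = d i * rightwardColumnOp N.1 a i j + u i * rightwardColumnOp N.1 a k j) :
    flagInvariant M = flagInvariant N := by
  refine flagInvariant_eq_of_eq_mul_rightwardColumnOp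
    (L := Matrix.diagonal d + Matrix.vecMulVec u (Pi.single k 1)) ⟨fun i j hij => ?_, fun i => ?_⟩
    a ?_
  · rcases eq_or_ne j k with rfl | hjk
    · simp [Matrix.vecMulVec_apply, hij.ne, hu i hij.le]
    · simp [hij.ne, Matrix.vecMulVec_apply, hjk]
  · rcases eq_or_ne i k with rfl | hik
    · simpa [Matrix.vecMulVec_apply, hu i le_rfl] using hd i
    · simpa [Matrix.vecMulVec_apply, hik] using hd i
  · ext i j
    rw [h, Matrix.add_mul, Matrix.add_apply, Matrix.diagonal_mul, Matrix.mul_apply]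
    simp [Matrix.vecMulVec_apply, Pi.single_apply]

end Orbits

theorem swapLetters_apply {b : ℕ} (s : FlagState b) (m n : ℕ) (i : Fin b) :
    swapLetters s m n i = Equiv.swap m n (s i) := rfl

section PendingMatrix

variable {F : Type*} [Field F] {b : ℕ}

/-- The vector `c` with the entries outside the rows of the labels at the positions `1, …, n` of
`s` replaced by zero: the rows at which the leftward walk of the backward process still has to
flip a coin. -/
def pendingColumn (s : FlagState b) (n : ℕ) (c : Fin b → F) (i : Fin b) : F :=
  if s i ∈ Finset.Icc 1 n then c i else 0

theorem linearIndependent_permMatrix_add_pendingColumn (s : FlagState b) (n : ℕ) (c : Fin b → F) :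
    LinearIndependent F
      (permMatrix F s + Matrix.vecMulVec (pendingColumn s n c) (Pi.single 0 1)).row := by
  rw [Fintype.linearIndependent_iff]
  intro g hg
  have column_eq_zero : ∀ j, ∑ i, g i * ((if s i = j then 1 else 0) +
      pendingColumn s n c i * (Pi.single 0 1 : ℕ → F) j) = 0 := fun j => by
    simpa [Matrix.row, permMatrix, Matrix.vecMulVec_apply] using congrFun hg j
  have eq_zero_of_ne : ∀ i, s i ≠ 0 → g i = 0 := fun i hi => by
    simpa [hi, s.injective.eq_iff] using column_eq_zero (s i)
  intro i
  by_cases hi : s i = 0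
  · have h := column_eq_zero 0
    rw [Finset.sum_eq_single i (fun m _ hm => ?_) (by simp)] at h
    · simpa [hi, pendingColumn] using h
    · rw [eq_zero_of_ne m fun hm0 => hm (s.injective (hm0.trans hi.symm)), zero_mul]
  · exact eq_zero_of_ne i hi

/-- The stage of the reduction of `[c M]` which corresponds to the stage `s` of the leftward walk
with the positions `n, …, 1` still to be visited: column `0` stands for the hand. -/
def pendingMatrix (s : FlagState b) (n : ℕ) (c : Fin b → F) : FullRankMatrix F b :=
  ⟨permMatrix F s + Matrix.vecMulVec (pendingColumn s n c) (Pi.single 0 1),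
    linearIndependent_permMatrix_add_pendingColumn s n c⟩

theorem pendingMatrix_apply (s : FlagState b) (n : ℕ) (c : Fin b → F) (i : Fin b) (j : ℕ) :
    (pendingMatrix s n c).1 i j =
      (if s i = j then 1 else 0) + if j = 0 then pendingColumn s n c i else 0 := by
  simp [pendingMatrix, permMatrix, Matrix.vecMulVec_apply, Pi.single_apply]

theorem rightwardColumnOp_pendingMatrix (s : FlagState b) (n : ℕ) (c : Fin b → F)
    (a : ℕ → ℕ → F) (i : Fin b) (j : ℕ) :
    rightwardColumnOp (pendingMatrix s n c).1 a i j =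
      (if s i = j then 1 else if s i < j then a (s i) j else 0) +
        pendingColumn s n c i * if j = 0 then 1 else a 0 j := by
  rw [← colOp_permMatrix]
  cases j with
  | zero => simp [rightwardColumnOp, pendingMatrix_apply, permMatrix]
  | succ j =>
    simp [rightwardColumnOp, pendingMatrix_apply, permMatrix, add_mul, Finset.sum_add_distrib,
      add_assoc]

theorem flagInvariant_pendingMatrix_zero (s : FlagState b) (c : Fin b → F) :
    flagInvariant (pendingMatrix s 0 c) = s := by
  rw [flagInvariant_eq_iff]
  convert (hasPivots_permMatrix (F := F) s).inOrbit
  ext i j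
  simp [pendingMatrix_apply, pendingColumn, permMatrix]

theorem pendingMatrix_congr {s : FlagState b} {m n : ℕ} {c d : Fin b → F}
    (h : pendingColumn s m c = pendingColumn s n d) : pendingMatrix s m c = pendingMatrix s n d :=
  Subtype.ext (by simp only [pendingMatrix, h])

theorem pendingColumn_update_of_notMem (s : FlagState b) (n : ℕ) (c : Fin b → F) {k : Fin b}
    (hk : s k ∉ Finset.Icc 1 n) (x : F) :
    pendingColumn s n (Function.update c k x) = pendingColumn s n c := by
  ext i
  rcases eq_or_ne i k with rfl | hik
  · simp only [pendingColumn, if_neg hk]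
  · simp only [pendingColumn, Function.update_of_ne hik]

theorem pendingColumn_succ (s : FlagState b) (n : ℕ) (c : Fin b → F) (i : Fin b) :
    pendingColumn s (n + 1) c i = pendingColumn s n c i + if s i = n + 1 then c i else 0 := by
  by_cases h : s i = n + 1
  · simp [pendingColumn, h]
  · have : s i ≤ n + 1 ↔ s i ≤ n := by omega
    simp [pendingColumn, h, this]

theorem pendingMatrix_succ_of_eq_zero (s : FlagState b) (n : ℕ) (c : Fin b → F)
    (h : ∀ k, s k = n + 1 → c k = 0) : pendingMatrix s (n + 1) c = pendingMatrix s n c := by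
  refine pendingMatrix_congr (funext fun i => ?_)
  rw [pendingColumn_succ, ite_eq_right_iff.2 (h i), add_zero]

theorem flagInvariant_pendingMatrix_succ_of_held_lt (s : FlagState b) (n : ℕ) (c : Fin b → F)
    {h k : Fin b} (hh : s h = 0) (hk : s k = n + 1) (hlt : h < k) :
    flagInvariant (pendingMatrix s (n + 1) c) = flagInvariant (pendingMatrix s n c) := by
  refine flagInvariant_eq_of_scale_add_row 0 h 1 (Pi.single k (c k)) (fun _ => one_ne_zero)
    (fun _ hi => Pi.single_eq_of_ne (hi.trans_lt hlt).ne _) fun i j => ?_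
  have hki : s i = n + 1 ↔ i = k := by rw [← hk, s.injective.eq_iff]
  simp only [rightwardColumnOp_pendingMatrix, pendingMatrix_apply, pendingColumn_succ, hki,
    Pi.single_apply]
  have held_eq_zero : pendingColumn s n c h = 0 := by simp [pendingColumn, hh]
  rw [held_eq_zero, hh]
  rcases eq_or_ne j 0 with rfl | hj <;> rcases eq_or_ne i k with rfl | hik <;>
    simp [*, eq_comm (a := (0 : ℕ))]

theorem flagInvariant_pendingMatrix_succ_of_le (s : FlagState b) (n : ℕ) (c : Fin b → F)
    (hle : letter s 0 ≤ letter s (n + 1)) :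
    flagInvariant (pendingMatrix s (n + 1) c) = flagInvariant (pendingMatrix s n c) := by
  by_cases label : ∃ k, s k = n + 1
  · obtain ⟨k, hk⟩ := label
    rw [(letter_eq_coe_iff s _ k).2 hk] at hle
    obtain ⟨h, hh, hhk⟩ := WithTop.le_coe_iff.1 hle
    rw [letter_eq_coe_iff] at hh
    have hne : h ≠ k := by rintro rfl; omega
    exact flagInvariant_pendingMatrix_succ_of_held_lt s n c hh hk (hhk.lt_of_ne hne)
  · rw [pendingMatrix_succ_of_eq_zero s n c fun k hk => (label ⟨k, hk⟩).elim]

theorem pendingColumn_swapLetters (s : FlagState b) (n : ℕ) (c : Fin b → F) :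
    pendingColumn (swapLetters s 0 (n + 1)) n c = pendingColumn s n c := by
  ext i
  simp only [pendingColumn, swapLetters_apply, Equiv.swap_apply_def, Finset.mem_Icc]
  split_ifs <;> first | rfl | omega

theorem exists_rightwardColumnOp_pendingMatrix_swapLetters_eq (s : FlagState b) (n : ℕ)
    (c : Fin b → F) {k : Fin b} (hk : s k = n + 1) (hc : c k ≠ 0) :
    ∃ a, ∀ i j, rightwardColumnOp (pendingMatrix (swapLetters s 0 (n + 1)) n c).1 a i j =
      (if swapLetters s 0 (n + 1) i = j then 1 else 0) +
        if j = 0 then pendingColumn s n c i else if i = k ∧ j = n + 1 then (c k)⁻¹ else 0 := by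
  have hki : ∀ i, s i = n + 1 ↔ i = k := fun i => by rw [← hk, s.injective.eq_iff]
  -- Column `0`, divided by `c k`, is added to column `n + 1`; the other columns then clear the
  -- entries of column `n + 1` outside row `k`.
  refine ⟨fun x y => if y = n + 1 then
    (if x = 0 then 1 else -Function.extend s c 0 x) / c k else 0, fun i j => ?_⟩
  rw [rightwardColumnOp_pendingMatrix, pendingColumn_swapLetters, swapLetters_apply]
  rcases eq_or_ne j (n + 1) with rfl | hj
  · rcases eq_or_ne i k with rfl | hik
    · simp [pendingColumn, hk]
    rcases eq_or_ne (s i) 0 with h0 | h0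
    · simp [pendingColumn, hik, h0]
    · have hs : s i ≠ n + 1 := mt (hki i).1 hik
      have hmem : s i ∈ Finset.Icc 1 n ↔ s i < n + 1 := by rw [Finset.mem_Icc]; omega
      rw [Equiv.swap_apply_of_ne_of_ne h0 hs]
      by_cases hlt : s i < n + 1
      · simp only [pendingColumn, hmem, hlt, hik, h0, hs, s.injective.extend_apply, if_true,
          if_false, false_and, Nat.add_one_ne_zero]
        ring
      · simp [pendingColumn, hmem, hlt, hik, hs]
  · rcases eq_or_ne j 0 with rfl | hj0 <;> simp [*]

theorem flagInvariant_pendingMatrix_succ_of_ne_zero (s : FlagState b) (n : ℕ) (c : Fin b → F)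
    {k : Fin b} (hk : s k = n + 1) (hlt : ∀ h, s h = 0 → k < h) (hc : c k ≠ 0) :
    flagInvariant (pendingMatrix s (n + 1) c) =
      flagInvariant (pendingMatrix (swapLetters s 0 (n + 1)) n c) := by
  obtain ⟨a, ha⟩ := exists_rightwardColumnOp_pendingMatrix_swapLetters_eq s n c hk hc
  -- Row `k` is rescaled so that its entry in column `n + 1` is `1`; if the hand holds a label, that
  -- entry then moves the `1` in the row of this label from column `n + 1` to column `0`.
  refine flagInvariant_eq_of_scale_add_row a k
    (fun i => if s i = 0 then -(c k)⁻¹ else if i = k then c k else 1)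
    (fun i => if s i = 0 then 1 else 0) (fun i => ?_) (fun i hi => ?_) fun i j => ?_
  · split_ifs <;> simp [hc]
  · exact if_neg fun h0 => (hlt i h0).not_ge hi
  have hki : s i = n + 1 ↔ i = k := by rw [← hk, s.injective.eq_iff]
  have hk0 : pendingColumn s n c k = 0 := by simp [pendingColumn, hk]
  rw [ha, ha, pendingMatrix_apply, pendingColumn_succ]
  rcases eq_or_ne i k with rfl | hik
  · rcases eq_or_ne j 0 with rfl | hj
    · simp [swapLetters_apply, hk, hk0]
    · simp [swapLetters_apply, hk, hc, hj, hj.symm, eq_comm (a := j)]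
  rcases eq_or_ne (s i) 0 with h0 | h0
  · have hi : pendingColumn s n c i = 0 := by simp [pendingColumn, h0]
    rcases eq_or_ne j 0 with rfl | hj
    · simp [swapLetters_apply, hk, h0, hi, hk0]
    · rcases eq_or_ne j (n + 1) with rfl | hj' <;>
        simp [swapLetters_apply, *, hj.symm, eq_comm (a := n + 1)]
  · have hs : s i ≠ n + 1 := mt hki.1 hik
    simp [swapLetters_apply, Equiv.swap_apply_of_ne_of_ne h0 hs, h0, hik, hs]

end PendingMatrix

section UniformVectors

theorem map_equiv_uniformOfFintype {α β : Type*} [Fintype α] [Nonempty α] [Fintype β] [Nonempty β]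
    (e : α ≃ β) : (PMF.uniformOfFintype α).map e = PMF.uniformOfFintype β := by
  classical
  ext y
  rw [PMF.map_apply, tsum_eq_single (e.symm y) fun x hx => if_neg fun h => hx (by simp [h])]
  simp [Fintype.card_congr e]

theorem uniformOfFintype_prod (α β : Type*) [Fintype α] [Nonempty α] [Fintype β] [Nonempty β] :
    PMF.uniformOfFintype (α × β) =
      (PMF.uniformOfFintype α).bind fun x => (PMF.uniformOfFintype β).map (Prod.mk x) := by
  classical
  ext ⟨x, y⟩
  rw [PMF.bind_apply, tsum_eq_single x fun x' hx' => ?_, PMF.map_apply,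
    tsum_eq_single y fun y' hy' => ?_]
  · simp [ENNReal.mul_inv]
  · simpa using hy'.symm
  · simp [PMF.map_apply, hx'.symm]

theorem uniformOfFintype_pi_eq_bind_update {ι G : Type*} [Fintype ι] [DecidableEq ι] [Fintype G]
    [Nonempty G] (k : ι) :
    PMF.uniformOfFintype (ι → G) = (PMF.uniformOfFintype G).bind fun x =>
      (PMF.uniformOfFintype (ι → G)).map fun c => Function.update c k x := by
  -- Exchanging `x` with the entry `c k` is an involution, so it preserves the uniform distribution.
  have involutive : Function.Involutive fun p : G × (ι → G) =>
    (p.2 k, Function.update p.2 k p.1) := fun p => by simp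
  calc PMF.uniformOfFintype (ι → G) = (PMF.uniformOfFintype (G × (ι → G))).map Prod.snd := by
        simp [uniformOfFintype_prod, PMF.map_bind, PMF.map_comp, Function.comp_def,
          ← Function.id_def, PMF.map_id]
    _ = (PMF.uniformOfFintype (G × (ι → G))).map fun p => Function.update p.2 k p.1 := by
        conv_lhs => rw [← map_equiv_uniformOfFintype involutive.toPerm, PMF.map_comp]
        rfl
    _ = _ := by
        simp only [uniformOfFintype_prod, PMF.map_bind, PMF.map_comp, Function.comp_def]

theorem map_eq_zero_uniformOfFintype (F : Type*) [Field F] [Fintype F] [DecidableEq F] :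
    (PMF.uniformOfFintype F).map (fun x => decide (x = 0)) =
      coin (Fintype.card F) (one_le_card F) := by
  have apply_true : (PMF.uniformOfFintype F).map (fun x => decide (x = 0)) true =
      coin (Fintype.card F) (one_le_card F) true := by
    rw [PMF.map_apply, tsum_eq_single 0 fun x hx => by simp [hx]]
    have card_ne_zero : (Fintype.card F : ℝ≥0) ≠ 0 := by simp
    simp [coin, ENNReal.coe_inv card_ne_zero]
  have apply_false : ∀ p : PMF Bool, p false = 1 - p true := fun p => by
    have h := p.tsum_coe
    rw [tsum_fintype, Fintype.sum_bool] at h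
    rw [← h, ENNReal.add_sub_cancel_left (p.apply_ne_top _)]
  ext heads
  cases heads
  · rw [apply_false, apply_false, apply_true]
  · exact apply_true

theorem map_uniformOfFintype_eq_coin_bind {F ι α : Type*} [Field F] [Fintype F] [Fintype ι]
    [DecidableEq ι] (k : ι) {f g h : (ι → F) → α}
    (hzero : ∀ c, f (Function.update c k 0) = g c)
    (hne : ∀ c x, x ≠ 0 → f (Function.update c k x) = h c) :
    (PMF.uniformOfFintype (ι → F)).map f = (coin (Fintype.card F) (one_le_card F)).bind
      fun heads => if heads then (PMF.uniformOfFintype (ι → F)).map g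
        else (PMF.uniformOfFintype (ι → F)).map h := by
  classical
  conv_lhs => rw [uniformOfFintype_pi_eq_bind_update k, PMF.map_bind]
  rw [← map_eq_zero_uniformOfFintype, PMF.bind_map]
  congr 1
  funext x
  rcases eq_or_ne x 0 with rfl | hx
  · simp [PMF.map_comp, Function.comp_def, hzero]
  · simp [PMF.map_comp, Function.comp_def, hne _ x hx, hx]

end UniformVectors

theorem map_flagInvariant_pendingMatrix_uniformOfFintype {F : Type*} [Field F] [Fintype F] {b : ℕ}
    (n : ℕ) (s : FlagState b) :
    (PMF.uniformOfFintype (Fin b → F)).map (fun c => flagInvariant (pendingMatrix s n c)) =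
      backwardWalk (Fintype.card F) (one_le_card F) n s := by
  induction n generalizing s with
  | zero =>
    simp only [flagInvariant_pendingMatrix_zero]
    exact PMF.map_const _ _
  | succ n ih =>
    rw [backwardWalk]
    split_ifs with hlt
    · obtain ⟨k, hk⟩ := WithTop.ne_top_iff_exists.1 hlt.ne_top
      have hsk := (letter_eq_coe_iff s (n + 1) k).1 hk.symm
      have held_lt : ∀ h, s h = 0 → k < h := fun h hh => by
        rwa [← hk, (letter_eq_coe_iff s 0 h).2 hh, WithTop.coe_lt_coe] at hlt
      simp only [← ih]
      refine map_uniformOfFintype_eq_coin_bind k (fun c => ?_) fun c x hx => ?_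
      · rw [pendingMatrix_succ_of_eq_zero s n _ fun i hi => ?_,
          pendingMatrix_congr (pendingColumn_update_of_notMem s n c (by simp [hsk]) 0)]
        rw [s.injective (hi.trans hsk.symm), Function.update_self]
      · rw [flagInvariant_pendingMatrix_succ_of_ne_zero s n _ hsk held_lt (by simpa using hx),
          pendingMatrix_congr (pendingColumn_update_of_notMem _ n c
            (by simp [swapLetters_apply, hsk]) x)]
    · rw [← ih]
      congr 1
      funext c
      exact flagInvariant_pendingMatrix_succ_of_le s n c (not_lt.1 hlt)

section LeftColumn

variable {F : Type*} [Field F] {b : ℕ}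

theorem attachDash_apply (s : FlagState b) (i : Fin b) : attachDash s i = s i + 1 := rfl

theorem lt_width (s : FlagState b) (i : Fin b) : s i < width s :=
  Finset.le_sup (f := fun i => s i + 1) (Finset.mem_univ i)

theorem flagInvariant_prependColumn_mulVec {M : FullRankMatrix F b} {τ : FlagState b}
    {L : Matrix (Fin b) (Fin b) F} {a : ℕ → ℕ → F} (hL : IsDownwardRowOp L)
    (hM : M.1 = L * rightwardColumnOp (permMatrix F τ) a) (c : Fin b → F) :
    flagInvariant (prependColumn (L.mulVec c) M) =
      flagInvariant (pendingMatrix (attachDash τ) (width τ) c) := by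
  have pending_eq : pendingColumn (attachDash τ) (width τ) c = c := funext fun i =>
    if_pos (Finset.mem_Icc.2 ⟨Nat.succ_pos _, lt_width τ i⟩)
  refine flagInvariant_eq_of_eq_mul_rightwardColumnOp hL
    (fun x y => if x = 0 then 0 else a (x - 1) (y - 1)) ?_
  ext i j
  rw [Matrix.mul_apply]
  simp only [rightwardColumnOp_pendingMatrix, pending_eq, attachDash_apply]
  cases j with
  | zero => simp [prependColumn, Matrix.mulVec, dotProduct]
  | succ j =>
    simp [prependColumn, hM, Matrix.mul_apply, colOp_permMatrix]

theorem IsDownwardRowOp.mulVec_injective {L : Matrix (Fin b) (Fin b) F} (hL : IsDownwardRowOp L) :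
    Function.Injective L.mulVec := fun v w h => by
  have h' : L.mulVec (v - w) = 0 := by rw [Matrix.mulVec_sub, h, sub_self]
  funext i
  exact sub_eq_zero.1 (lower_zero hL (v - w) (fun i => congrFun h' i) i)

theorem randomColumnLaw_eq_backwardBumping [Fintype F] (M : FullRankMatrix F b) :
    randomColumnLaw M =
      backwardBumping (Fintype.card F) (one_le_card F) (flagInvariant M) := by
  obtain ⟨L, a, hL, hM⟩ := (flagInvariant_eq_iff M _).1 rfl
  have hbij : Function.Bijective L.mulVec := Finite.injective_iff_bijective.1 hL.mulVec_injective
  rw [randomColumnLaw, ← map_equiv_uniformOfFintype (Equiv.ofBijective _ hbij), PMF.map_comp,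
    backwardBumping, ← map_flagInvariant_pendingMatrix_uniformOfFintype]
  congr 1
  funext c
  exact flagInvariant_prependColumn_mulVec hL hM c

end LeftColumn

section Support

variable {b : ℕ}

theorem swapLetters_swapLetters (s : FlagState b) (m n : ℕ) :
    swapLetters (swapLetters s m n) m n = s := by
  ext i
  simp [swapLetters_apply]

theorem letter_swapLetters (s : FlagState b) (m n j : ℕ) :
    letter (swapLetters s m n) j = letter s (Equiv.swap m n j) := by
  simp only [letter, swapLetters_apply, Equiv.swap_apply_eq_iff]

theorem letter_swapLetters_left (s : FlagState b) (m n : ℕ) :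
    letter (swapLetters s m n) m = letter s n := by
  rw [letter_swapLetters, Equiv.swap_apply_left]

theorem letter_swapLetters_right (s : FlagState b) (m n : ℕ) :
    letter (swapLetters s m n) n = letter s m := by
  rw [letter_swapLetters, Equiv.swap_apply_right]

theorem letter_attachDash_zero (s : FlagState b) : letter (attachDash s) 0 = ⊤ :=
  (letter_eq_top_iff _ _).2 fun i => Nat.succ_ne_zero (s i)

/-- The word `u`, with a dash at position `0`, can be obtained from `s` by a throw resumed at
position `n + 1`, or else `s` is `u` itself and nothing is held.  For `n = 0` these are the edges
of the digraph; this is the invariant of the leftward walk started at `u`. -/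
def FlagEdgeFrom (u : FlagState b) (n : ℕ) (s : FlagState b) : Prop :=
  (letter s 0 = ⊤ ∧ s = u) ∨ (letter s 0 ≠ ⊤ ∧ ThrowWalk u (n + 1) s)

theorem FlagEdgeFrom.of_succ {u s : FlagState b} {n : ℕ} (h : FlagEdgeFrom u (n + 1) s) :
    FlagEdgeFrom u n s :=
  h.imp_right (And.imp_right (.skip _ _))

theorem FlagEdgeFrom.swapLetters {u s : FlagState b} {n : ℕ} (h : FlagEdgeFrom u (n + 1) s)
    (hlt : letter s (n + 1) < letter s 0) : FlagEdgeFrom u n (swapLetters s 0 (n + 1)) := by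
  refine Or.inr ⟨by rw [letter_swapLetters_left]; exact hlt.ne_top, ?_⟩
  rcases h with ⟨h0, rfl⟩ | ⟨h0, hw⟩
  · exact .place _ _ (by rwa [letter_swapLetters_right]) (swapLetters_swapLetters _ _ _)
  · refine .bump _ _ ?_ ?_ ?_
    · rwa [letter_swapLetters_right]
    · rwa [letter_swapLetters_left, letter_swapLetters_right]
    · rwa [swapLetters_swapLetters]

variable {q : ℝ≥0}

theorem support_coin (hq : 1 < q) : (coin q hq.le).support = Set.univ := by
  have inv_lt_one : ((q⁻¹ : ℝ≥0) : ℝ≥0∞) < 1 := by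
    exact_mod_cast inv_lt_one_of_one_lt₀ hq
  ext heads
  cases heads
  · simpa only [coin, PMF.mem_support_iff, PMF.ofFintype_apply, cond_false, Set.mem_univ, iff_true]
      using (tsub_pos_of_lt inv_lt_one).ne'
  · simp [coin, (zero_lt_one.trans hq).ne']

theorem mem_support_backwardWalk_succ (hq : 1 < q) (n : ℕ) (s t : FlagState b) :
    t ∈ (backwardWalk q hq.le (n + 1) s).support ↔
      t ∈ (backwardWalk q hq.le n s).support ∨ (letter s (n + 1) < letter s 0 ∧
        t ∈ (backwardWalk q hq.le n (swapLetters s 0 (n + 1))).support) := by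
  rw [backwardWalk]
  split_ifs with h
  · rw [PMF.mem_support_bind_iff, support_coin hq]
    simp [h, or_comm]
  · simp [h]

theorem mem_support_backwardWalk_mono (hq : 1 < q) {m n : ℕ} (hmn : m ≤ n) {s t : FlagState b}
    (h : t ∈ (backwardWalk q hq.le m s).support) : t ∈ (backwardWalk q hq.le n s).support := by
  induction hmn with
  | refl => exact h
  | step _ ih => exact (mem_support_backwardWalk_succ hq _ _ _).2 (Or.inl ih)

theorem FlagEdgeFrom.of_mem_support_backwardWalk (hq : 1 < q) {u s t : FlagState b} {n : ℕ}
    (h : FlagEdgeFrom u n s) (ht : t ∈ (backwardWalk q hq.le n s).support) :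
    FlagEdgeFrom u 0 t := by
  induction n generalizing s with
  | zero =>
    obtain rfl : t = s := by simpa [backwardWalk] using ht
    exact h
  | succ n ih =>
    rcases (mem_support_backwardWalk_succ hq _ _ _).1 ht with ht | ⟨hlt, ht⟩
    · exact ih h.of_succ ht
    · exact ih (h.swapLetters hlt) ht

theorem ThrowWalk.mem_support_backwardWalk (hq : 1 < q) {u s t : FlagState b} {n N : ℕ}
    (hN : ∀ i, u i ≤ N) (hw : ThrowWalk u (n + 1) s) (h0 : letter s 0 ≠ ⊤)
    (ht : t ∈ (backwardWalk q hq.le n s).support) : t ∈ (backwardWalk q hq.le N u).support := by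
  generalize hm : n + 1 = m at hw
  induction hw generalizing n with
  | skip m s _ ih =>
    subst hm
    exact ih h0 (mem_support_backwardWalk_mono hq n.le_succ ht) rfl
  | bump m s _ hlt _ ih =>
    subst hm
    refine ih (by rwa [letter_swapLetters_left]) ?_ rfl
    rw [mem_support_backwardWalk_succ hq, letter_swapLetters_left, letter_swapLetters_right,
      swapLetters_swapLetters]
    exact Or.inr ⟨hlt, ht⟩
  | place m s htop hs =>
    subst hm hs
    obtain ⟨k, hk⟩ := WithTop.ne_top_iff_exists.1 h0
    have landing : swapLetters s 0 (n + 1) k = n + 1 := by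
      rw [← letter_eq_coe_iff, letter_swapLetters_right, hk]
    refine mem_support_backwardWalk_mono hq (landing ▸ hN k) ?_
    rw [mem_support_backwardWalk_succ hq, letter_swapLetters_left, letter_swapLetters_right,
      swapLetters_swapLetters, htop]
    exact Or.inr ⟨lt_top_iff_ne_top.2 h0, ht⟩

theorem mem_support_backwardBumping_iff (hq : 1 < q) (τ t : FlagState b) :
    t ∈ (backwardBumping q hq.le τ).support ↔ FlagEdge t τ := by
  have mem_support_zero : t ∈ (backwardWalk q hq.le 0 t).support := by simp [backwardWalk]
  refine ⟨FlagEdgeFrom.of_mem_support_backwardWalk hq (Or.inl ⟨letter_attachDash_zero τ, rfl⟩), ?_⟩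
  rintro (⟨_, rfl⟩ | ⟨h0, hw⟩)
  · exact mem_support_backwardWalk_mono hq (Nat.zero_le _) mem_support_zero
  · exact hw.mem_support_backwardWalk hq (lt_width τ) h0 mem_support_zero

end Support

end FlagJuggling

theorem mainTheorem8_general {F : Type*} [Field F] [Fintype F] {b : ℕ}
    (τ : FlagJuggling.FlagState b) (M : FlagJuggling.FullRankMatrix F b)
    (hτ : FlagJuggling.flagInvariant M = τ) :
    (∀ τ' : FlagJuggling.FlagState b,
      FlagJuggling.randomColumnLaw M τ' =
        FlagJuggling.backwardBumping (Fintype.card F) (FlagJuggling.one_le_card F) τ τ') ∧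
    (∀ τ' : FlagJuggling.FlagState b,
      τ' ∈ (FlagJuggling.randomColumnLaw M).support ↔ FlagJuggling.FlagEdge τ' τ) := by
  have one_lt_card : (1 : ℝ≥0) < Fintype.card F := by exact_mod_cast Fintype.one_lt_card
  rw [FlagJuggling.randomColumnLaw_eq_backwardBumping, hτ]
  exact ⟨fun _ => rfl, FlagJuggling.mem_support_backwardBumping_iff one_lt_card τ⟩

theorem mainTheorem8 {F : Type*} [Field F] [Fintype F] {b : ℕ}
    (τ : FlagJuggling.FlagState b) (M : FlagJuggling.FullRankMatrix F b)
    (hM : FlagJuggling.IsPartialPermutation M.1) (hτ : FlagJuggling.flagInvariant M = τ) :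
    (∀ τ' : FlagJuggling.FlagState b,
      FlagJuggling.randomColumnLaw M τ' =
        FlagJuggling.backwardBumping (Fintype.card F) (FlagJuggling.one_le_card F) τ τ') ∧
    (∀ τ' : FlagJuggling.FlagState b,
      τ' ∈ (FlagJuggling.randomColumnLaw M).support ↔ FlagJuggling.FlagEdge τ' τ) :=
  mainTheorem8_general τ M hτ
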